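/- A \emph{Wang tile} is a unit square with coloured sides; write $(q,a,b,q')$ for the tile with west colour $q$, south colour $a$, north colour $b$ and east colour $q'$. A \emph{tiling} of the plane by a finite set $\mathcal S$ of Wang tiles assigns a tile of $\mathcal S$ to every cell of $\mathbb Z^2$ so that sides of adjacent cells that touch have the same colour. Let $C_{\mathcal S}(n)$ be the number of different $n\times n$ patterns which appear in tilings of the plane by $\mathcal S$. The \emph{entropy} of $\mathcal S$ is $H(\mathcal S)=\lim_{n\to\infty}\frac{\log C_{\mathcal S}(n)}{n^2}$. A \emph{substitutive pair} of $\mathcal S$ is a couple of different patterns of the same size, both correctly tiled by $\mathcal S$, with the same colours along their borders. The \emph{Kari–Culik tileset} $\mathcal K$ has horizontal sides coloured by $0,0',1,2$, vertical sides coloured by five different colours $\frac03,\frac13,\frac23$ and $0,1$, and consists of the 13 tiles $$(0,0,0',0),\ (1,0,0',1),\ (0,1,1,1),\ (1,0,1,0),\ (0,1,2,0),\ (1,1,2,1),\ (1,0',1,0),$$ $$(\tfrac03,2,1,\tfrac13),\ (\tfrac13,2,1,\tfrac23),\ (\tfrac13,1,0,\tfrac03),\ (\tfrac23,2,0,\tfrac03),\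 (\tfrac23,1,0,\tfrac13),\ (\tfrac03,1,1,\tfrac23).$$ Write $\begin{bmatrix} s & t\\ u & v\end{bmatrix}$ for the $2\times2$ pattern with upper row $s,t$ and lower row $u,v$, and put $$A_1=\begin{bmatrix}(\frac23,2,0,\frac03)&(\frac03,1,1,\frac23)\\(0,1,2,0)&(0,1,1,1)\end{bmatrix},\qquad A_1'=\begin{bmatrix}(\frac23,1,0,\frac13)&(\frac13,2,1,\frac23)\\(0,1,1,1)&(1,1,2,1)\end{bmatrix},$$ $$A_2=\begin{bmatrix}(\frac03,2,1,\frac13)&(\frac13,1,0,\frac03)\\(0,1,2,0)&(0,1,1,1)\end{bmatrix},\qquad A_2'=\begin{bmatrix}(\frac03,1,1,\frac23)&(\frac23,2,0,\frac03)\\(0,1,1,1)&(1,1,2,1)\end{bmatrix}.$$ \textbf{Theorem.} The Kari–Culik tileset $\mathcal K$ has positive entropy: the limit $H(\mathcal K)=\lim_{n\to\infty}\frac{\log C_{\mathcal K}(n)}{n^2}$ exists and $H(\mathcal K)>0$. Moreover $(A_1,A_1')$ and $(A_2,A_2')$ are substitutive pairs of $\mathcal K$, and there is an $N$ such that in every tiling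 of the plane by $\mathcal K$, every $N\times N$ square of cells contains an occurrence of at least one of $A_1,A_1',A_2,A_2'$. -/

import Mathlib

open Filter Topology

/-- A Wang tile: a unit square with coloured sides. Horizontal sides (north, south) carry colours
from `H`, vertical sides (west, east) carry colours from `V`. -/
structure WangTile (H V : Type) where
  west : V
  north : H
  south : H
  east : V
deriving DecidableEq

/-- A rectangular pattern of `m` columns and `n` rows; `p i j` is the tile in column `i`
(from left to right) and row `j` (from bottom to top). -/
abbrev Pattern (H V : Type) (m n : ℕ) : Type := Fin m → Fin n → WangTile H V

/-- A tiling of the plane by the tileset `τ`: a tile of `τ` in every cell `(x, y)`, where `x` grows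
eastwards and `y` northwards, such that any two adjacent sides have the same colour. -/
structure IsTiling {H V : Type} (τ : Finset (WangTile H V)) (T : ℤ → ℤ → WangTile H V) : Prop where
  mem : ∀ x y, T x y ∈ τ
  horizontal : ∀ x y, (T x y).east = (T (x + 1) y).west
  vertical : ∀ x y, (T x y).north = (T x (y + 1)).south

/-- The pattern `p` occurs in the configuration `T` with lower left cell `(x, y)`. -/
def OccursAt {H V : Type} {m n : ℕ} (p : Pattern H V m n) (T : ℤ → ℤ → WangTile H V)
    (x y : ℤ) : Prop :=
  ∀ (i : Fin m) (j : Fin n), T (x + (i : ℕ)) (y + (j : ℕ)) = p i j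

/-- The `n × n` patterns which appear in some tiling of the plane by `τ`. -/
def tilingPatterns {H V : Type} (τ : Finset (WangTile H V)) (n : ℕ) : Set (Pattern H V n n) :=
  {p | ∃ T, IsTiling τ T ∧ ∃ x y : ℤ, OccursAt p T x y}

theorem tilingPatterns_finite {H V : Type} (τ : Finset (WangTile H V)) (n : ℕ) :
    (tilingPatterns τ n).Finite := by
  refine Set.Finite.subset
    (Set.Finite.pi' (fun _ : Fin n => Set.Finite.pi' (fun _ : Fin n => τ.finite_toSet))) ?_
  rintro p ⟨T, hT, x, y, h⟩ i j
  rw [← h i j]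
  exact hT.mem _ _

/-- `C(n)`: the number of `n × n` patterns which appear in tilings by `τ`. -/
noncomputable def complexity {H V : Type} (τ : Finset (WangTile H V)) (n : ℕ) : ℕ :=
  (tilingPatterns τ n).ncard

/-- The tileset `τ` has entropy `h`: `log C(n) / n²` converges to `h`. -/
def HasEntropy {H V : Type} (τ : Finset (WangTile H V)) (h : ℝ) : Prop :=
  Tendsto (fun n : ℕ => Real.log (complexity τ n) / (n : ℝ) ^ 2) atTop (𝓝 h)

/-- A rectangular pattern which is correctly tiled by `τ`. -/
structure IsTiledPattern {H V : Type} {m n : ℕ} (τ : Finset (WangTile H V))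
    (p : Pattern H V m n) : Prop where
  mem : ∀ i j, p i j ∈ τ
  horizontal : ∀ (i i' : Fin m) (j : Fin n), (i : ℕ) + 1 = i' → (p i j).east = (p i' j).west
  vertical : ∀ (i : Fin m) (j j' : Fin n), (j : ℕ) + 1 = j' → (p i j).north = (p i j').south

/-- Two patterns of the same size carry the same colours along their borders. -/
structure SameBorder {H V : Type} {m n : ℕ} (p q : Pattern H V m n) : Prop where
  west : ∀ (i : Fin m) (j : Fin n), (i : ℕ) = 0 → (p i j).west = (q i j).west
  east : ∀ (i : Fin m) (j : Fin n), (i : ℕ) + 1 = m → (p i j).east = (q i j).east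
  south : ∀ (i : Fin m) (j : Fin n), (j : ℕ) = 0 → (p i j).south = (q i j).south
  north : ∀ (i : Fin m) (j : Fin n), (j : ℕ) + 1 = n → (p i j).north = (q i j).north

/-- A substitutive pair of `τ`: two different patterns with the same borders. -/
structure IsSubstitutivePair {H V : Type} {m n : ℕ} (τ : Finset (WangTile H V))
    (p q : Pattern H V m n) : Prop where
  tiled_left : IsTiledPattern τ p
  tiled_right : IsTiledPattern τ q
  ne : p ≠ q
  border : SameBorder p q

namespace KariCulik

/-- Colours of the horizontal sides: `0`, `0′`, `1`, `2`. -/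
inductive Letter
  | zero
  | zeroPrime
  | one
  | two
deriving DecidableEq

/-- Colours of the vertical sides: the states `0/3`, `1/3`, `2/3` of the automaton dividing by
three, and the states `0`, `1` of the automaton multiplying by two (five different colours). -/
inductive State
  | third0
  | third1
  | third2
  | double0
  | double1
deriving DecidableEq

/-- The tile of the transition `q --(a, b)--> q'`: state `q` on the west side, `a` on the south
side, `b` on the north side, state `q'` on the east side. -/
def tile (q : State) (a b : Letter) (q' : State) : WangTile Letter State :=
  { west := q, north := b, south := a, east := q' }

open Letter State

/-- The Kari–Culik tileset, with 13 tiles. -/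
def tileset : Finset (WangTile Letter State) :=
  { -- multiplication by two
    tile double0 zero zeroPrime double0,
    tile double1 zero zeroPrime double1,
    tile double0 one one double1,
    tile double1 zero one double0,
    tile double0 one two double0,
    tile double1 one two double1,
    tile double1 zeroPrime one double0,
    -- division by three
    tile third0 two one third1,
    tile third1 two one third2,
    tile third1 one zero third0,
    tile third2 two zero third0,
    tile third2 one zero third1,
    tile third0 one one third2 }

/-- The `2 × 2` pattern with the given lower left, lower right, upper left and upper right tile. -/
def block (ll lr ul ur : WangTile Letter State) : Pattern Letter State 2 2 :=
  ![![ll, ul], ![lr, ur]]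

/-- The pattern `A₁`. -/
def A₁ : Pattern Letter State 2 2 :=
  block (tile double0 one two double0) (tile double0 one one double1)
    (tile third2 two zero third0) (tile third0 one one third2)

/-- The pattern `A′₁`. -/
def A₁' : Pattern Letter State 2 2 :=
  block (tile double0 one one double1) (tile double1 one two double1)
    (tile third2 one zero third1) (tile third1 two one third2)

/-- The pattern `A₂`. -/
def A₂ : Pattern Letter State 2 2 :=
  block (tile double0 one two double0) (tile double0 one one double1)
    (tile third0 two one third1) (tile third1 one zero third0)

/-- The pattern `A′₂`. -/
def A₂' : Pattern Letter State 2 2 :=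
  block (tile double0 one one double1) (tile double1 one two double1)
    (tile third0 one one third2) (tile third2 two zero third0)

end KariCulik

/-!
A row of tiles transforms the word on its south side into the word on its north side. With the
vertical colours read as carries, `q + 2a = b + q'` holds for the first seven tiles and
`q + b = a/3 + q'` for the other six: a row doubles the average of the word or divides it by three.

*A tiling exists.* The map `x ↦ 2x` (`x < 1`), `x ↦ x/3` (`1 ≤ x`) is a bijection of `[1/3, 2)`.
Along an orbit `a : ℤ → ℝ` of this map, the Beatty words `⌊(i + 1) a y⌋ - ⌊i a y⌋` are compatible
with carries in the range of the tileset (`KariCulik.exists_isTiling`).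

*The four patterns are unavoidable.* Whether a row doubles or divides is seen in each of its tiles.
Any eight consecutive rows contain one of six short sequences of kinds of rows
(`KariCulik.exists_blockWord`). For each of these sequences, a strip without any of the four
patterns has at most fourteen columns, which is established by exhaustive search
(`KariCulik.unavoidableIn_of_mem_blockWords`). So every `16 × 16` square contains one of the
patterns (`KariCulik.exists_blockAt`).

*Entropy.* A large square is covered by translates of a smaller one, so
`C(n) ≤ C(m) ^ (k ^ 2)` if `n ≤ k m` (`complexity_le_pow`), and `log C(n) / n²` converges to its
infimum (`exists_hasEntropy`). In a fixed tiling, each square of a `16 × 16` grid contains a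
pattern which can be exchanged for the other member of its substitutive pair. The exchanges in
different squares do not interact, so that `C(16 k) ≥ 2 ^ (k ^ 2)` (`two_pow_le_complexity`), and
the entropy is at least `log 2 / 16²`.
-/

/-! ### Unavoidability of the substitutive pairs -/

namespace KariCulik

open Letter State

/-- The tiles of the rows which multiply by two (`true`) or divide by three (`false`). -/
def rowTiles : Bool → List (WangTile Letter State)
  | true => [tile double0 zero zeroPrime double0, tile double1 zero zeroPrime double1,
      tile double0 one one double1, tile double1 zero one double0, tile double0 one two double0,
      tile double1 one two double1, tile double1 zeroPrime one double0]
  | false => [tile third0 two one third1, tile third1 two one third2, tile third1 one zero third0,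
      tile third2 two zero third0, tile third2 one zero third1, tile third0 one one third2]

/-- The tiles with the given west colour. -/
def tilesFrom : State → List (WangTile Letter State)
  | double0 => [tile double0 zero zeroPrime double0, tile double0 one one double1,
      tile double0 one two double0]
  | double1 => [tile double1 zero zeroPrime double1, tile double1 zero one double0,
      tile double1 one two double1, tile double1 zeroPrime one double0]
  | third0 => [tile third0 two one third1, tile third0 one one third2]
  | third1 => [tile third1 two one third2, tile third1 one zero third0]
  | third2 => [tile third2 two zero third0, tile third2 one zero third1]

/-- The kind of row in which a west colour is used: `true` for multiplication by two. -/
def isDouble : State → Bool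
  | double0 | double1 => true
  | third0 | third1 | third2 => false

theorem mem_rowTiles : ∀ t ∈ tileset, t ∈ rowTiles (isDouble t.west) := by decide

theorem mem_tilesFrom : ∀ t ∈ tileset, t ∈ tilesFrom t.west := by decide

/-- Whether the tile `t` may be put below the column `c`; columns are listed from bottom to top. -/
def fitsBelow (t : WangTile Letter State) : List (WangTile Letter State) → Bool
  | [] => true
  | u :: _ => t.north = u.south

/-- The correctly tiled columns whose `j`-th tile is taken from the `j`-th list. -/
def columns : List (List (WangTile Letter State)) → List (List (WangTile Letter State))
  | [] => [[]]
  | L :: Ls => (columns Ls).flatMap fun c => (L.filter (fitsBelow · c)).map (· :: c)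

/-- Whether the four tiles (lower left, lower right, upper left, upper right) form one of the
patterns of the two substitutive pairs. -/
def isBlock (ll lr ul ur : WangTile Letter State) : Bool :=
  [A₁, A₁', A₂, A₂'].any fun p => ll = p 0 0 && lr = p 1 0 && ul = p 0 1 && ur = p 1 1

/-- Whether one of the patterns of the substitutive pairs occurs in two adjacent columns. -/
def hasBlock : List (WangTile Letter State) → List (WangTile Letter State) → Bool
  | a :: a' :: c, b :: b' :: d => isBlock a b a' b' || hasBlock (a' :: c) (b' :: d)
  | _, _ => false

/-- Exhaustive search: any `n` columns which continue the column `c` to the east produce one of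
the patterns of the substitutive pairs. -/
def blockWithin : ℕ → List (WangTile Letter State) → Bool
  | 0, _ => false
  | n + 1, c =>
    (columns (c.map fun t => tilesFrom t.east)).all fun d => hasBlock c d || blockWithin n d

/-- Whether any `n + 1` consecutive columns of a strip contain one of the patterns of the
substitutive pairs, where `w` gives the kinds of the rows of the strip from bottom to top. -/
def unavoidableIn (w : List Bool) (n : ℕ) : Bool := (columns (w.map rowTiles)).all (blockWithin n)

/-- Sequences of kinds of rows in which the patterns of the substitutive pairs are unavoidable.
All except the third and the last one are impossible in a tiling of the plane. -/
def blockWords : List (List Bool) :=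
  [[false, false], [true, true, true, true], [true, false, true, false],
    [false, true, true, true], [true, true, true, false, true, true],
    [false, true, true, false, true, true]]

theorem unavoidableIn_of_mem_blockWords : ∀ w ∈ blockWords, unavoidableIn w 14 = true := by
  decide +kernel

theorem exists_blockWord : ∀ v : Fin 8 → Bool, ∃ d : Fin 7, ∃ w ∈ blockWords,
    w <+: (List.ofFn v).drop d := by
  decide +kernel

section Columns

variable {T : ℤ → ℤ → WangTile Letter State}

/-- The `h` tiles of `T` in column `x` from row `y` upwards. -/
def column (T : ℤ → ℤ → WangTile Letter State) (x y : ℤ) : ℕ → List (WangTile Letter State)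
  | 0 => []
  | h + 1 => T x y :: column T x (y + 1) h

theorem length_column (x y : ℤ) (h : ℕ) : (column T x y h).length = h := by
  induction h generalizing y with
  | zero => rfl
  | succ h ih => simp [column, ih]

theorem take_column (x y : ℤ) {k h : ℕ} (hk : k ≤ h) :
    (column T x y h).take k = column T x y k := by
  induction k generalizing y h with
  | zero => rfl
  | succ k ih =>
    obtain ⟨h, rfl⟩ : ∃ h', h = h' + 1 := ⟨h - 1, by omega⟩
    simp [column, ih (y + 1) (by omega : k ≤ h)]

theorem drop_column (x y : ℤ) (d h : ℕ) :
    (column T x y (d + h)).drop d = column T x (y + d) h := by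
  induction d generalizing y with
  | zero => simp
  | succ d ih =>
    rw [show d + 1 + h = d + h + 1 by omega, column, List.drop_succ_cons, ih]
    congr 1
    push_cast
    ring

theorem column_mem_columns (hT : IsTiling tileset T) (x y : ℤ) (h : ℕ)
    (Ls : List (List (WangTile Letter State)))
    (hL : List.Forall₂ (· ∈ ·) (column T x y h) Ls) : column T x y h ∈ columns Ls := by
  induction h generalizing y Ls with
  | zero =>
    cases hL
    simp [columns, column]
  | succ h ih =>
    cases hL with
    | cons h₁ h₂ =>
      simp only [columns, List.mem_flatMap, List.mem_map, List.mem_filter]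
      refine ⟨_, ih _ _ h₂, _, ⟨h₁, ?_⟩, rfl⟩
      cases h with
      | zero => rfl
      | succ h => simpa [column, fitsBelow] using hT.vertical x y

theorem forall₂_rowTiles (hT : IsTiling tileset T) (x y : ℤ) (h : ℕ) :
    List.Forall₂ (· ∈ ·) (column T x y h)
      (((column T x y h).map fun t => isDouble t.west).map rowTiles) := by
  induction h generalizing y with
  | zero => exact List.Forall₂.nil
  | succ h ih => exact List.Forall₂.cons (mem_rowTiles _ (hT.mem x y)) (ih _)

theorem forall₂_tilesFrom (hT : IsTiling tileset T) (x y : ℤ) (h : ℕ) :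
    List.Forall₂ (· ∈ ·) (column T (x + 1) y h)
      ((column T x y h).map fun t => tilesFrom t.east) := by
  induction h generalizing y with
  | zero => exact List.Forall₂.nil
  | succ h ih =>
    refine List.Forall₂.cons ?_ (ih _)
    rw [show (fun t => tilesFrom t.east) (T x y) = tilesFrom (T (x + 1) y).west from
      congrArg tilesFrom (hT.horizontal x y)]
    exact mem_tilesFrom _ (hT.mem (x + 1) y)

/-- One of the four patterns of the substitutive pairs occurs at `(x, y)`. -/
def BlockAt (T : ℤ → ℤ → WangTile Letter State) (x y : ℤ) : Prop :=
  OccursAt A₁ T x y ∨ OccursAt A₁' T x y ∨ OccursAt A₂ T x y ∨ OccursAt A₂' T x y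

theorem blockAt_of_isBlock {x y : ℤ}
    (h : isBlock (T x y) (T (x + 1) y) (T x (y + 1)) (T (x + 1) (y + 1)) = true) :
    BlockAt T x y := by
  have key : ∀ p : Pattern Letter State 2 2, (((T x y = p 0 0 ∧ T (x + 1) y = p 1 0) ∧
      T x (y + 1) = p 0 1) ∧ T (x + 1) (y + 1) = p 1 1) → OccursAt p T x y := by
    rintro p ⟨⟨⟨h₁, h₂⟩, h₃⟩, h₄⟩ i j
    fin_cases i <;> fin_cases j <;> simpa
  simp only [isBlock, List.any_cons, List.any_nil, Bool.or_eq_true, Bool.and_eq_true,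
    decide_eq_true_eq, Bool.or_false] at h
  exact h.imp (key _) (Or.imp (key _) (Or.imp (key _) (key _)))

theorem exists_blockAt_of_hasBlock (x y : ℤ) (h : ℕ)
    (hb : hasBlock (column T x y h) (column T (x + 1) y h) = true) :
    ∃ j : ℕ, j + 2 ≤ h ∧ BlockAt T x (y + j) := by
  induction h generalizing y with
  | zero => simp [column, hasBlock] at hb
  | succ h ih =>
    cases h with
    | zero => simp [column, hasBlock] at hb
    | succ h =>
      simp only [column, hasBlock, Bool.or_eq_true] at hb
      rcases hb with hb | hb
      · exact ⟨0, by omega, by simpa using blockAt_of_isBlock hb⟩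
      · obtain ⟨j, hj, hj'⟩ := ih (y + 1) hb
        refine ⟨j + 1, by omega, ?_⟩
        rw [show y + ((j + 1 : ℕ) : ℤ) = y + 1 + j by push_cast; ring]
        exact hj'

theorem exists_blockAt_of_blockWithin (hT : IsTiling tileset T) (x y : ℤ) (h n : ℕ)
    (hs : blockWithin n (column T x y h) = true) :
    ∃ i j : ℕ, i < n ∧ j + 2 ≤ h ∧ BlockAt T (x + i) (y + j) := by
  induction n generalizing x with
  | zero => simp [blockWithin] at hs
  | succ n ih =>
    rw [blockWithin, List.all_eq_true] at hs
    have := hs _ (column_mem_columns hT _ _ _ _ (forall₂_tilesFrom hT x y h))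
    rw [Bool.or_eq_true] at this
    rcases this with hb | hb
    · obtain ⟨j, hj, hj'⟩ := exists_blockAt_of_hasBlock x y h hb
      exact ⟨0, j, by omega, hj, by simpa using hj'⟩
    · obtain ⟨i, j, hi, hj, hij⟩ := ih (x + 1) hb
      refine ⟨i + 1, j, by omega, hj, ?_⟩
      rw [show x + ((i + 1 : ℕ) : ℤ) = x + 1 + i by push_cast; ring]
      exact hij

/-- Eight consecutive rows contain a block word, and a search through the columns of the
corresponding strip finds a pattern within `15` columns. -/
theorem exists_blockAt (hT : IsTiling tileset T) (x y : ℤ) :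
    ∃ i j : ℕ, i + 2 ≤ 16 ∧ j + 2 ≤ 16 ∧ BlockAt T (x + i) (y + j) := by
  obtain ⟨d, w, hw, hpre⟩ := exists_blockWord fun j => isDouble (T x (y + (j : ℕ))).west
  have hcol : (List.ofFn fun j : Fin 8 => isDouble (T x (y + (j : ℕ))).west) =
      (column T x y 8).map fun t => isDouble t.west := by
    simp [column, List.ofFn_succ, Fin.succ, add_assoc]
  have hd : (d : ℕ) < 7 := d.2
  rw [hcol, ← List.map_drop, show 8 = (d : ℕ) + (8 - d) by omega, drop_column] at hpre
  have hlen : w.length ≤ 8 - d := by simpa [length_column] using hpre.length_le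
  rw [List.prefix_iff_eq_take, ← List.map_take, take_column _ _ hlen] at hpre
  have hs := unavoidableIn_of_mem_blockWords w hw
  rw [unavoidableIn, List.all_eq_true] at hs
  have hmem := column_mem_columns hT _ _ _ _ (forall₂_rowTiles hT x (y + (d : ℕ)) w.length)
  rw [← hpre] at hmem
  obtain ⟨i, j, hi, hj, hij⟩ := exists_blockAt_of_blockWithin hT _ _ _ _ (hs _ hmem)
  refine ⟨i, d + j, by omega, by omega, ?_⟩
  rwa [Nat.cast_add, ← add_assoc]

end Columns

theorem isSubstitutivePair_A₁ : IsSubstitutivePair tileset A₁ A₁' :=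
  ⟨⟨by decide, by decide, by decide⟩, ⟨by decide, by decide, by decide⟩, by decide,
    ⟨by decide, by decide, by decide, by decide⟩⟩

theorem isSubstitutivePair_A₂ : IsSubstitutivePair tileset A₂ A₂' :=
  ⟨⟨by decide, by decide, by decide⟩, ⟨by decide, by decide, by decide⟩, by decide,
    ⟨by decide, by decide, by decide, by decide⟩⟩

end KariCulik

/-! ### Existence of a tiling -/

namespace KariCulik

open Letter State

/-- The piecewise linear bijection `x ↦ 2x` (if `x < 1`), `x ↦ x/3` (if `1 ≤ x`) of `[1/3, 2)`. -/
noncomputable def averageMap : Equiv.Perm (Set.Ico (1 / 3 : ℝ) 2) where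
  toFun x := if h : (x : ℝ) < 1 then ⟨2 * x, by have := x.2.1; constructor <;> linarith⟩
    else ⟨x / 3, by have := x.2.2; constructor <;> linarith⟩
  invFun x := if h : (x : ℝ) < 2 / 3 then ⟨3 * x, by have := x.2.1; constructor <;> linarith⟩
    else ⟨x / 2, by have := x.2.2; constructor <;> linarith⟩
  left_inv x := by
    obtain ⟨x, h₁, h₂⟩ := x
    by_cases h : x < 1
    · have : ¬ 2 * x < 2 / 3 := by linarith
      simp [h, this]
    · have : x / 3 < 2 / 3 := by linarith
      simp only [h, this, dite_true, dite_false]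
      exact Subtype.ext (by simp only; ring)
  right_inv x := by
    obtain ⟨x, h₁, h₂⟩ := x
    by_cases h : x < 2 / 3
    · have : ¬ 3 * x < 1 := by linarith
      simp [h, this]
    · have : x / 2 < 1 := by linarith
      simp only [h, this, dite_true, dite_false]
      exact Subtype.ext (by simp only; ring)

/-- A bi-infinite orbit of the bijection of `[1/3, 2)`, to be used as averages of rows. -/
theorem exists_orbit : ∃ a : ℤ → ℝ, ∀ y, 1 / 3 ≤ a y ∧ a y < 2 ∧
    (a y < 1 → a (y + 1) = 2 * a y) ∧ (1 ≤ a y → a (y + 1) = a y / 3) := by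
  let z : ℤ → Set.Ico (1 / 3 : ℝ) 2 := fun y => (averageMap ^ y) ⟨1, by norm_num, by norm_num⟩
  have hz (y) : z (y + 1) = averageMap (z y) := by
    simp only [z, add_comm y 1, zpow_one_add, Equiv.Perm.mul_apply]
  refine ⟨fun y => z y, fun y => ⟨(z y).2.1, (z y).2.2, fun h => ?_, fun h => ?_⟩⟩
  · simp only [hz, averageMap, Equiv.coe_fn_mk, dif_pos h]
  · simp only [hz, averageMap, Equiv.coe_fn_mk, dif_neg (not_lt.2 h)]

/-- The letter with the given value; `prime` tells whether the value `0` is written `0′`. -/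
def letterOf (prime : Bool) (v : ℤ) : Letter :=
  if v = 0 then bif prime then zeroPrime else zero else if v = 1 then one else two

/-- The state `q` of the automaton multiplying by two. -/
def doubleState (q : ℤ) : State := if q = 0 then double0 else double1

/-- The state `r/3` of the automaton dividing by three. -/
def thirdState (r : ℤ) : State := if r = 0 then third0 else if r = 1 then third1 else third2

theorem double_tile_mem {prime : Bool} {q a b q' : ℤ} (hq : 0 ≤ q ∧ q ≤ 1) (hq' : 0 ≤ q' ∧ q' ≤ 1)
    (ha : 0 ≤ a ∧ a ≤ 1) (hb : 0 ≤ b ∧ b ≤ 2) (h : q + 2 * a = b + q')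
    (hp : (prime = false ∧ b ≤ 1) ∨ 1 ≤ b) :
    tile (doubleState q) (letterOf prime a) (letterOf true b) (doubleState q') ∈ tileset := by
  obtain ⟨h₁, h₂⟩ := hq
  obtain ⟨h₃, h₄⟩ := ha
  obtain ⟨h₅, h₆⟩ := hb
  obtain rfl : q' = q + 2 * a - b := by omega
  interval_cases q <;> interval_cases a <;> interval_cases b <;> try omega
  all_goals cases prime <;> first | decide | simp at hp

theorem third_tile_mem {prime : Bool} {q a b q' : ℤ} (hq : 0 ≤ q ∧ q ≤ 2) (hq' : 0 ≤ q' ∧ q' ≤ 2)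
    (ha : 1 ≤ a ∧ a ≤ 2) (hb : 0 ≤ b ∧ b ≤ 1) (h : q + 3 * b = a + q') :
    tile (thirdState q) (letterOf prime a) (letterOf false b) (thirdState q') ∈ tileset := by
  obtain ⟨h₁, h₂⟩ := hq
  obtain ⟨h₃, h₄⟩ := ha
  obtain ⟨h₅, h₆⟩ := hb
  obtain rfl : q' = q + 3 * b - a := by omega
  interval_cases q <;> interval_cases a <;> interval_cases b <;> try omega
  all_goals cases prime <;> decide

/-- The rows are the Beatty sequences `⌊(i + 1) a⌋ - ⌊i a⌋` of the averages `a` of an orbit, and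
the states are the carries between the Beatty sequences of consecutive averages. -/
theorem exists_isTiling : ∃ T, IsTiling tileset T := by
  obtain ⟨a, ha⟩ := exists_orbit
  let s : ℤ → ℤ → ℤ := fun i y => ⌊i * a y⌋
  let l : ℤ → ℤ → Letter := fun i y => letterOf (decide (a (y - 1) < 1)) (s (i + 1) y - s i y)
  let st : ℤ → ℤ → State := fun i y =>
    if a y < 1 then doubleState (2 * s i y - s i (y + 1) + 1)
    else thirdState (3 * s i (y + 1) - s i y + 2)
  refine ⟨fun i y => tile (st i y) (l i y) (l i (y + 1)) (st (i + 1) y), fun i y => ?_,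
    fun i y => rfl, fun i y => rfl⟩
  obtain ⟨h₁, h₂, h₃, h₄⟩ := ha y
  have lo (i y : ℤ) : (s i y : ℝ) ≤ i * a y := Int.floor_le _
  have hi (i y : ℤ) : (i * a y : ℝ) < s i y + 1 := Int.lt_floor_add_one _
  have a₁ := lo i y
  have a₂ := hi i y
  have a₃ := lo (i + 1) y
  have a₄ := hi (i + 1) y
  have b₁ := lo i (y + 1)
  have b₂ := hi i (y + 1)
  have b₃ := lo (i + 1) (y + 1)
  have b₄ := hi (i + 1) (y + 1)
  push_cast at a₃ a₄ b₃ b₄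
  have int_le {m n : ℤ} (h : (m : ℝ) < n + 1) : m ≤ n := by
    exact Int.lt_add_one_iff.1 (by exact_mod_cast h)
  by_cases h : a y < 1
  · rw [h₃ h] at b₁ b₂ b₃ b₄
    simp only [l, st, h, if_true, add_sub_cancel_right, decide_true]
    refine double_tile_mem ⟨int_le ?_, int_le ?_⟩ ⟨int_le ?_, int_le ?_⟩ ⟨int_le ?_, int_le ?_⟩
      ⟨int_le ?_, int_le ?_⟩ (by ring) ?_
    any_goals (push_cast; linarith)
    by_cases h' : a y < 1 / 2
    · refine Or.inl ⟨?_, int_le (by push_cast; linarith)⟩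
      -- a doubled average is at least `2/3`, so the row below divides and its zeros are plain
      rw [decide_eq_false_iff_not]
      intro hlt
      have := (ha (y - 1)).2.2.1 hlt
      rw [sub_add_cancel] at this
      linarith [(ha (y - 1)).1]
    · exact Or.inr (int_le (by push_cast; linarith))
  · rw [h₄ (not_lt.1 h)] at b₁ b₂ b₃ b₄
    simp only [l, st, h, if_false, add_sub_cancel_right, decide_false]
    refine third_tile_mem ⟨int_le ?_, int_le ?_⟩ ⟨int_le ?_, int_le ?_⟩ ⟨int_le ?_, int_le ?_⟩
      ⟨int_le ?_, int_le ?_⟩ (by ring)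
    all_goals (push_cast; linarith)

end KariCulik

/-! ### Existence of the entropy -/

section Entropy

variable {H V : Type} {τ : Finset (WangTile H V)} {T : ℤ → ℤ → WangTile H V}

theorem one_le_complexity (hT : IsTiling τ T) (n : ℕ) : 1 ≤ complexity τ n :=
  (Set.ncard_pos (tilingPatterns_finite τ n)).2
    ⟨fun i j => T (0 + (i : ℕ)) (0 + (j : ℕ)), T, hT, 0, 0, fun _ _ => rfl⟩

/-- A pattern of size `n ≤ k m` is determined by `k²` patterns of size `m` which cover it. -/
theorem complexity_le_pow (τ : Finset (WangTile H V)) {n m k : ℕ} (h : n ≤ k * m) :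
    complexity τ n ≤ complexity τ m ^ (k * k) := by
  have := (tilingPatterns_finite τ m).to_subtype
  choose T hT x y hxy using fun p : tilingPatterns τ n => p.2
  let φ : tilingPatterns τ n → (Fin k × Fin k → tilingPatterns τ m) := fun p ab =>
    ⟨fun i j => T p (x p + m * (ab.1 : ℕ) + (i : ℕ)) (y p + m * (ab.2 : ℕ) + (j : ℕ)),
      T p, hT p, _, _, fun _ _ => rfl⟩
  have hφ : Function.Injective φ := by
    intro p p' hpp
    ext1
    funext i j
    have hm : 0 < m := by
      rcases Nat.eq_zero_or_pos m with rfl | hm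
      · exact absurd i.2 (by omega)
      · exact hm
    have hdiv (i : Fin n) : (i : ℕ) / m < k := by
      rw [Nat.div_lt_iff_lt_mul hm]
      omega
    have hcast (z : ℤ) (i : Fin n) :
        z + m * ((i : ℕ) / m : ℕ) + ((i : ℕ) % m : ℕ) = z + (i : ℕ) := by
      rw [add_assoc]
      congr 1
      exact_mod_cast Nat.div_add_mod (i : ℕ) m
    have := congrArg (fun f => (f (⟨i / m, hdiv i⟩, ⟨j / m, hdiv j⟩) : Pattern H V m m)
      ⟨i % m, Nat.mod_lt _ hm⟩ ⟨j % m, Nat.mod_lt _ hm⟩) hpp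
    simp only [φ, hcast] at this
    rw [← hxy p i j, ← hxy p' i j]
    exact this
  have hcard := Nat.card_le_card_of_injective φ hφ
  rwa [Nat.card_fun, Nat.card_prod, Nat.card_fin] at hcard

theorem log_complexity_div_sq_le (hT : IsTiling τ T) {m n : ℕ} (hm : 0 < m) (hn : 0 < n) :
    Real.log (complexity τ n) / (n : ℝ) ^ 2 ≤
      Real.log (complexity τ m) * (1 / m + 1 / n) ^ 2 := by
  have hm' : (0 : ℝ) < m := by exact_mod_cast hm
  have hn' : (0 : ℝ) < n := by exact_mod_cast hn
  have hle : (complexity τ n : ℝ) ≤ (complexity τ m : ℝ) ^ ((n / m + 1) * (n / m + 1)) := by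
    refine mod_cast complexity_le_pow τ ?_
    rw [add_one_mul]
    exact (Nat.lt_div_mul_add hm).le
  have hlog := Real.log_le_log (by exact_mod_cast one_le_complexity hT n) hle
  rw [Real.log_pow] at hlog
  have hpos : 0 ≤ Real.log (complexity τ m) :=
    Real.log_nonneg (by exact_mod_cast one_le_complexity hT m)
  have hdiv : ((n / m : ℕ) : ℝ) ≤ n / m := Nat.cast_div_le
  rw [div_le_iff₀ (by positivity)]
  push_cast at hlog
  calc Real.log (complexity τ n)
      ≤ ((n / m : ℕ) + 1) * ((n / m : ℕ) + 1) * Real.log (complexity τ m) := hlog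
    _ ≤ ((n / m : ℝ) + 1) * ((n / m : ℝ) + 1) * Real.log (complexity τ m) := by gcongr
    _ = _ := by field_simp

/-- Submultiplicativity makes `log C(n) / n²` converge to its infimum. -/
theorem exists_hasEntropy (hT : IsTiling τ T) : ∃ h, HasEntropy τ h := by
  set u : ℕ → ℝ := fun n => Real.log (complexity τ n) / (n : ℝ) ^ 2 with hu
  have hbdd : BddBelow (u '' Set.Ici 1) := by
    refine ⟨0, ?_⟩
    rintro _ ⟨n, -, rfl⟩
    exact div_nonneg (Real.log_nonneg (by exact_mod_cast one_le_complexity hT n)) (by positivity)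
  refine ⟨sInf (u '' Set.Ici 1), tendsto_order.2 ⟨fun a ha => ?_, fun a ha => ?_⟩⟩
  · filter_upwards [eventually_ge_atTop 1] with n hn
    exact ha.trans_le (csInf_le hbdd ⟨n, hn, rfl⟩)
  · obtain ⟨_, ⟨m, hm, rfl⟩, hma⟩ := exists_lt_of_csInf_lt (Set.Nonempty.image u ⟨1, Set.mem_Ici.2 le_rfl⟩) ha
    have hlim : Tendsto (fun n : ℕ => Real.log (complexity τ m) * (1 / m + 1 / (n : ℝ)) ^ 2) atTop
        (𝓝 (Real.log (complexity τ m) * (1 / m + 0) ^ 2)) :=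
      ((tendsto_const_nhds.add tendsto_one_div_atTop_nhds_zero_nat).pow 2).const_mul _
    have hval : Real.log (complexity τ m) * (1 / m + 0) ^ 2 < a := by
      refine lt_of_eq_of_lt ?_ hma
      rw [add_zero, hu]
      field_simp
    filter_upwards [hlim.eventually (gt_mem_nhds hval), eventually_ge_atTop 1] with n hn hn'
    exact (log_complexity_div_sq_le hT hm hn').trans_lt hn

/-! ### Substitutions in disjoint squares -/

open Classical in
/-- The configuration `T`, with the pattern `q` written at `(x₀, y₀)`. -/
noncomputable def overwrite {m n : ℕ} (T : ℤ → ℤ → WangTile H V) (q : Pattern H V m n)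
    (x₀ y₀ : ℤ) : ℤ → ℤ → WangTile H V := fun x y =>
  if h : ∃ ij : Fin m × Fin n, x = x₀ + (ij.1 : ℕ) ∧ y = y₀ + (ij.2 : ℕ) then
    q h.choose.1 h.choose.2
  else T x y

theorem overwrite_of_mem {m n : ℕ} (T : ℤ → ℤ → WangTile H V) (q : Pattern H V m n) (x₀ y₀ : ℤ)
    (i : Fin m) (j : Fin n) : overwrite T q x₀ y₀ (x₀ + (i : ℕ)) (y₀ + (j : ℕ)) = q i j := by
  have h : ∃ ij : Fin m × Fin n,
      x₀ + ((i : ℕ) : ℤ) = x₀ + (ij.1 : ℕ) ∧ y₀ + ((j : ℕ) : ℤ) = y₀ + (ij.2 : ℕ) :=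
    ⟨(i, j), rfl, rfl⟩
  have h₁ : h.choose.1 = i := Fin.ext (by have := h.choose_spec.1; omega)
  have h₂ : h.choose.2 = j := Fin.ext (by have := h.choose_spec.2; omega)
  rw [overwrite, dif_pos h, h₁, h₂]

theorem overwrite_of_notMem {m n : ℕ} (T : ℤ → ℤ → WangTile H V) (q : Pattern H V m n)
    {x₀ y₀ x y : ℤ} (h : ¬ ∃ ij : Fin m × Fin n, x = x₀ + (ij.1 : ℕ) ∧ y = y₀ + (ij.2 : ℕ)) :
    overwrite T q x₀ y₀ x y = T x y := dif_neg h

/-- Replacing an occurrence of one pattern of a substitutive pair by the other one is harmless. -/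
theorem IsTiling.overwrite {m n : ℕ} {p q : Pattern H V m n} {x₀ y₀ : ℤ} (hT : IsTiling τ T)
    (hp : OccursAt p T x₀ y₀) (hpq : IsSubstitutivePair τ p q) :
    IsTiling τ (overwrite T q x₀ y₀) := by
  -- a side of a cell keeps its colour, unless it is shared by two cells of the rewritten pattern
  refine ⟨fun x y => ?_, fun x y => ?_, fun x y => ?_⟩
  · by_cases h : ∃ ij : Fin m × Fin n, x = x₀ + (ij.1 : ℕ) ∧ y = y₀ + (ij.2 : ℕ)
    · obtain ⟨⟨i, j⟩, rfl, rfl⟩ := h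
      rw [overwrite_of_mem]
      exact hpq.tiled_right.mem i j
    · rw [overwrite_of_notMem T q h]
      exact hT.mem x y
  · by_cases h : ∃ ij : Fin m × Fin n, x = x₀ + (ij.1 : ℕ) ∧ y = y₀ + (ij.2 : ℕ)
    · obtain ⟨⟨i, j⟩, rfl, rfl⟩ := h
      by_cases hi : (i : ℕ) + 1 < m
      · rw [show x₀ + ((i : ℕ) : ℤ) + 1 = x₀ + ((⟨i + 1, hi⟩ : Fin m) : ℕ) by push_cast; ring,
          overwrite_of_mem, overwrite_of_mem]
        exact hpq.tiled_right.horizontal i ⟨i + 1, hi⟩ j rfl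
      · rw [overwrite_of_mem, overwrite_of_notMem, ← hpq.border.east i j (by omega), ← hp i j,
          hT.horizontal]
        rintro ⟨⟨i', j'⟩, h₁, -⟩
        simp only at h₁
        omega
    · rw [overwrite_of_notMem T q h, hT.horizontal]
      by_cases h' : ∃ ij : Fin m × Fin n, x + 1 = x₀ + (ij.1 : ℕ) ∧ y = y₀ + (ij.2 : ℕ)
      · obtain ⟨⟨i, j⟩, h₁, rfl⟩ := h'
        simp only at h₁
        have hi : (i : ℕ) = 0 := by
          by_contra hi
          exact h ⟨(⟨i - 1, by omega⟩, j), by simp only; omega, rfl⟩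
        rw [h₁, overwrite_of_mem, hp i j, hpq.border.west i j hi]
      · rw [overwrite_of_notMem T q h']
  · by_cases h : ∃ ij : Fin m × Fin n, x = x₀ + (ij.1 : ℕ) ∧ y = y₀ + (ij.2 : ℕ)
    · obtain ⟨⟨i, j⟩, rfl, rfl⟩ := h
      by_cases hj : (j : ℕ) + 1 < n
      · rw [show y₀ + ((j : ℕ) : ℤ) + 1 = y₀ + ((⟨j + 1, hj⟩ : Fin n) : ℕ) by push_cast; ring,
          overwrite_of_mem, overwrite_of_mem]
        exact hpq.tiled_right.vertical i j ⟨j + 1, hj⟩ rfl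
      · rw [overwrite_of_mem, overwrite_of_notMem, ← hpq.border.north i j (by omega), ← hp i j,
          hT.vertical]
        rintro ⟨⟨i', j'⟩, -, h₁⟩
        simp only at h₁
        omega
    · rw [overwrite_of_notMem T q h, hT.vertical]
      by_cases h' : ∃ ij : Fin m × Fin n, x = x₀ + (ij.1 : ℕ) ∧ y + 1 = y₀ + (ij.2 : ℕ)
      · obtain ⟨⟨i, j⟩, rfl, h₁⟩ := h'
        simp only at h₁
        have hj : (j : ℕ) = 0 := by
          by_contra hj
          exact h ⟨(i, ⟨j - 1, by omega⟩), rfl, by simp only; omega⟩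
        rw [h₁, overwrite_of_mem, hp i j, hpq.border.south i j hj]
      · rw [overwrite_of_notMem T q h']

theorem IsSubstitutivePair.symm {m n : ℕ} {p q : Pattern H V m n}
    (h : IsSubstitutivePair τ p q) : IsSubstitutivePair τ q p :=
  ⟨h.tiled_right, h.tiled_left, h.ne.symm, fun i j e => (h.border.west i j e).symm,
    fun i j e => (h.border.east i j e).symm, fun i j e => (h.border.south i j e).symm,
    fun i j e => (h.border.north i j e).symm⟩

/-- The tiling `F` differs from `T`, and only inside the cells `(x, y)` with `x / N = a` and
`y / N = b`, which form an `N × N` square. -/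
structure IsLocalChange (T F : ℤ → ℤ → WangTile H V) (N : ℕ) (a b : ℤ) : Prop where
  eq : ∀ x y : ℤ, ¬ (x / N = a ∧ y / N = b) → F x y = T x y
  exists_ne : ∃ x y, F x y ≠ T x y

theorem exists_isLocalChange {m n N : ℕ} {p q : Pattern H V m n} {a b : ℤ} {i j : ℕ}
    (hT : IsTiling τ T) (hi : i + m ≤ N) (hj : j + n ≤ N)
    (hp : OccursAt p T (a * N + i) (b * N + j)) (hpq : IsSubstitutivePair τ p q) :
    ∃ F, IsTiling τ F ∧ IsLocalChange T F N a b := by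
  refine ⟨_, hT.overwrite hp hpq, fun x y hxy => overwrite_of_notMem _ _ ?_, ?_⟩
  · rintro ⟨⟨i', j'⟩, rfl, rfl⟩
    have hi' := i'.2
    have hj' := j'.2
    have hdiv {c : ℤ} {r : ℕ} (hr : r < N) : (c * N + r) / (N : ℤ) = c :=
      (Int.ediv_eq_iff_of_pos (by omega)).2 ⟨by omega, by omega⟩
    refine hxy ⟨?_, ?_⟩
    · rw [add_assoc, ← Nat.cast_add]
      exact hdiv (by simp only; omega)
    · rw [add_assoc, ← Nat.cast_add]
      exact hdiv (by simp only; omega)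
  · by_contra! hcon
    refine hpq.ne (funext fun i' => funext fun j' => ?_)
    rw [← hp i' j', ← hcon, overwrite_of_mem]

/-- Tilings which are local changes of `T` can be combined. -/
theorem IsTiling.glue {N : ℕ} (hT : IsTiling τ T) {F : ℤ → ℤ → ℤ → ℤ → WangTile H V}
    (hF : ∀ a b, IsTiling τ (F a b))
    (hFT : ∀ a b x y : ℤ, ¬ (x / N = a ∧ y / N = b) → F a b x y = T x y) :
    IsTiling τ fun x y => F (x / N) (y / N) x y := by
  refine ⟨fun x y => (hF _ _).mem x y, fun x y => ?_, fun x y => ?_⟩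
  · by_cases h : (x + 1) / (N : ℤ) = x / N
    · simp only [h]
      exact (hF _ _).horizontal x y
    · rw [(hF _ _).horizontal, hFT _ _ (x + 1) y (by tauto), ← (hF ((x + 1) / N) _).horizontal,
        hFT _ _ x y (by tauto), hT.horizontal]
  · by_cases h : (y + 1) / (N : ℤ) = y / N
    · simp only [h]
      exact (hF _ _).vertical x y
    · rw [(hF _ _).vertical, hFT _ _ x (y + 1) (by tauto), ← (hF _ ((y + 1) / N)).vertical,
        hFT _ _ x y (by tauto), hT.vertical]

theorem two_pow_le_complexity {N : ℕ} (hN : 0 < N) (hT : IsTiling τ T)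
    (h : ∀ a b : ℤ, ∃ F, IsTiling τ F ∧ IsLocalChange T F N a b) (k : ℕ) :
    2 ^ (k * k) ≤ complexity τ (k * N) := by
  classical
  choose F hF hFT using h
  -- the tiling obtained from a choice of squares in which `T` is changed
  let G : (Fin k × Fin k → Bool) → ℤ → ℤ → ℤ → ℤ → WangTile H V := fun s a b =>
    if ∃ i j : Fin k, a = (i : ℕ) ∧ b = (j : ℕ) ∧ s (i, j) = true then F a b else T
  have hG (s : Fin k × Fin k → Bool) : IsTiling τ fun x y => G s (x / N) (y / N) x y := by
    refine hT.glue (fun a b => ?_) (fun a b (x y : ℤ) hxy => ?_)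
    · simp only [G]
      split_ifs
      exacts [hF a b, hT]
    · simp only [G]
      split_ifs
      exacts [(hFT a b).eq x y hxy, rfl]
  let φ : (Fin k × Fin k → Bool) → tilingPatterns τ (k * N) := fun s =>
    ⟨fun i j => (fun x y => G s (x / N) (y / N) x y) (0 + ((i : ℕ) : ℤ)) (0 + ((j : ℕ) : ℤ)),
      _, hG s, 0, 0, fun _ _ => rfl⟩
  have hφ : Function.Injective φ := by
    intro s s' hss
    funext ⟨a, b⟩
    obtain ⟨x, y, hxy⟩ := (hFT (a : ℕ) (b : ℕ)).exists_ne
    obtain ⟨hx, hy⟩ : x / N = (a : ℕ) ∧ y / N = (b : ℕ) := by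
      by_contra hcon
      exact hxy ((hFT _ _).eq x y hcon)
    have hrange {z : ℤ} {c : Fin k} (hz : z / N = (c : ℕ)) : ∃ i : Fin (k * N), z = (i : ℕ) := by
      obtain ⟨h₁, h₂⟩ := (Int.ediv_eq_iff_of_pos (by omega)).1 hz
      have hc : ((c : ℕ) : ℤ) + 1 ≤ k := by exact_mod_cast c.2
      have h₀ : (0 : ℤ) ≤ z := le_trans (by positivity) h₁
      refine ⟨⟨z.toNat, ?_⟩, by simp [h₀]⟩
      zify
      rw [Int.toNat_of_nonneg h₀]
      nlinarith
    obtain ⟨i, rfl⟩ := hrange hx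
    obtain ⟨j, rfl⟩ := hrange hy
    have hval (s : Fin k × Fin k → Bool) : (φ s : Pattern H V (k * N) (k * N)) i j =
        if s (a, b) = true then F (a : ℕ) (b : ℕ) (i : ℕ) (j : ℕ) else T (i : ℕ) (j : ℕ) := by
      simp only [φ, G, zero_add, hx, hy]
      have : (∃ i j : Fin k, ((a : ℕ) : ℤ) = (i : ℕ) ∧ ((b : ℕ) : ℤ) = (j : ℕ) ∧
          s (i, j) = true) ↔ s (a, b) = true := by
        constructor
        · rintro ⟨i, j, h₁, h₂, h₃⟩
          obtain rfl : a = i := Fin.ext (by exact_mod_cast h₁)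
          obtain rfl : b = j := Fin.ext (by exact_mod_cast h₂)
          exact h₃
        · exact fun h => ⟨a, b, rfl, rfl, h⟩
      simp only [this]
      split_ifs <;> rfl
    have heq : (φ s : Pattern H V (k * N) (k * N)) i j =
        (φ s' : Pattern H V (k * N) (k * N)) i j := by
      rw [hss]
    rw [hval, hval] at heq
    rcases hs : s (a, b) <;> rcases hs' : s' (a, b) <;> simp [hs, hs'] at heq ⊢
    · exact hxy heq.symm
    · exact hxy heq
  have := (tilingPatterns_finite τ (k * N)).to_subtype
  have hcard := Nat.card_le_card_of_injective φ hφ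
  rwa [Nat.card_fun, Nat.card_prod, Nat.card_fin, Nat.card_eq_fintype_card, Fintype.card_bool]
    at hcard

/-- If every square of an `N × N` grid can be changed, the entropy is at least `log 2 / N²`. -/
theorem exists_pos_hasEntropy {N : ℕ} (hN : 0 < N) (hT : IsTiling τ T)
    (h : ∀ a b : ℤ, ∃ F, IsTiling τ F ∧ IsLocalChange T F N a b) :
    ∃ e : ℝ, 0 < e ∧ HasEntropy τ e := by
  obtain ⟨e, he⟩ := exists_hasEntropy hT
  refine ⟨e, ?_, he⟩
  have hsub : Tendsto (fun k : ℕ => k * N) atTop atTop := tendsto_id.atTop_mul_const' hN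
  have hN' : (0 : ℝ) < N := by exact_mod_cast hN
  refine lt_of_lt_of_le (div_pos (Real.log_pos one_lt_two) (by positivity : (0 : ℝ) < (N : ℝ) ^ 2))
    (ge_of_tendsto (he.comp hsub) ?_)
  filter_upwards [eventually_gt_atTop 0] with k hk
  have hk' : (0 : ℝ) < k := by exact_mod_cast hk
  have hpow : ((2 : ℝ) ^ (k * k)) ≤ complexity τ (k * N) := by
    exact_mod_cast two_pow_le_complexity hN hT h k
  have hlog := Real.log_le_log (by positivity) hpow
  rw [Real.log_pow] at hlog
  rw [Function.comp_apply, div_le_div_iff₀ (by positivity) (by positivity)]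
  push_cast at hlog ⊢
  calc Real.log 2 * (k * N) ^ 2 = k * k * Real.log 2 * N ^ 2 := by ring
    _ ≤ _ := by gcongr

end Entropy

/-! ### Conclusion -/

theorem mainTheorem1 :
    (∃ h : ℝ, 0 < h ∧ HasEntropy KariCulik.tileset h) ∧
    IsSubstitutivePair KariCulik.tileset KariCulik.A₁ KariCulik.A₁' ∧
    IsSubstitutivePair KariCulik.tileset KariCulik.A₂ KariCulik.A₂' ∧
    (∃ N : ℕ, ∀ T : ℤ → ℤ → WangTile KariCulik.Letter KariCulik.State,
      IsTiling KariCulik.tileset T → ∀ x y : ℤ,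
        ∃ i j : ℕ, i + 2 ≤ N ∧ j + 2 ≤ N ∧
          (OccursAt KariCulik.A₁ T (x + i) (y + j) ∨
            OccursAt KariCulik.A₁' T (x + i) (y + j) ∨
            OccursAt KariCulik.A₂ T (x + i) (y + j) ∨
            OccursAt KariCulik.A₂' T (x + i) (y + j))) := by
  refine ⟨?_, KariCulik.isSubstitutivePair_A₁, KariCulik.isSubstitutivePair_A₂, 16,
    fun T hT x y => KariCulik.exists_blockAt hT x y⟩
  obtain ⟨T, hT⟩ := KariCulik.exists_isTiling
  refine exists_pos_hasEntropy (N := 16) (by norm_num) hT fun a b => ?_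
  obtain ⟨i, j, hi, hj, h | h | h | h⟩ :=
    KariCulik.exists_blockAt hT (a * (16 : ℕ)) (b * (16 : ℕ))
  · exact exists_isLocalChange hT hi hj h KariCulik.isSubstitutivePair_A₁
  · exact exists_isLocalChange hT hi hj h KariCulik.isSubstitutivePair_A₁.symm
  · exact exists_isLocalChange hT hi hj h KariCulik.isSubstitutivePair_A₂
  · exact exists_isLocalChange hT hi hj h KariCulik.isSubstitutivePair_A₂.symm
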